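/- For functions $f,g\colon\mathbb N\to\mathbb N$ write $f\preccurlyeq g$ if there is an integer $\lambda>1$ such that $f(n)\le\lambda\, g(\lambda n)+\lambda$ for all $n\in\mathbb N$; write $f\sim g$ if $f\preccurlyeq g$ and $g\preccurlyeq f$; and write $f\prec g$ if $f\preccurlyeq g$ but not $f\sim g$. A formal power series $\Gamma(z)\in\mathbb Q[[z]]$ is called holonomic if there are an integer $r\ge 0$ and polynomials $p_0,\dots,p_r\in\mathbb Q[z]$ with $p_r\ne 0$ such that $p_0\Gamma+p_1\Gamma'+\cdots+p_r\Gamma^{(r)}=0$. **Theorem.** Let $\gamma\colon\mathbb N\to\mathbb N$ be a non-decreasing function that is strictly between polynomials, that is, $n^d\prec\gamma(n)\prec n^{d+1}$ for some $d\in\mathbb N$. Then the power series $\sum_{n\ge 0}\gamma(n)z^n$ is not holonomic. -/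

import Mathlib

open scoped Polynomial PowerSeries

/-- `f ≼ g` for functions `ℕ → ℕ`: there is `l > 1` with `f n ≤ l * g (l * n) + l` for all `n`.
The constant is a natural number, so that `g` can be evaluated at `l * n`. -/
def GrowthLE (f g : ℕ → ℕ) : Prop :=
  ∃ l : ℕ, 1 < l ∧ ∀ n : ℕ, f n ≤ l * g (l * n) + l

/-- Equivalence of growth functions: `f ∼ g`. -/
def GrowthEquiv (f g : ℕ → ℕ) : Prop :=
  GrowthLE f g ∧ GrowthLE g f

/-- `f ≺ g`: `f ≼ g`, but `f` and `g` are not equivalent. -/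
def GrowthLT (f g : ℕ → ℕ) : Prop :=
  GrowthLE f g ∧ ¬ GrowthEquiv f g

/-- A formal power series over `ℚ` is holonomic if it satisfies a linear differential equation
`p₀ F + p₁ F' + ⋯ + pᵣ F⁽ʳ⁾ = 0` of some finite order `r`, with polynomial coefficients
`pᵢ ∈ ℚ[z]` and leading coefficient `pᵣ ≠ 0`. -/
def IsHolonomic (F : ℚ⟦X⟧) : Prop :=
  ∃ (r : ℕ) (p : ℕ → ℚ[X]), p r ≠ 0 ∧
    ∑ i ∈ Finset.range (r + 1), (p i : ℚ⟦X⟧) * (PowerSeries.derivative ℚ)^[i] F = 0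

open Filter Topology

/-! A holonomic series with integer coefficients of polynomial growth is rational. Multiplying a
solution by the leading coefficient `p r` gains one power of `n` in the growth bound
(`CoeffGrowth.leading_pow_mul`). After clearing denominators, a high power of `p r` times the series
has integer coefficients of size `O(1/n)`, which eventually vanish.

A rational function has integral order at `1`, so the sum `f` satisfies either `f(x) =
O((1-x)^-(d+1))` or `f(x) ≥ c (1-x)^-(d+2)` as `x → 1⁻`. Comparing sums with coefficients, for
monotone `γ`, turns these into `γ ≼ n^d` and `n^(d+1) ≼ γ`; each contradicts strictness. -/

/-- The coefficients of `F` are `O((n + 1) ^ a)`. -/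
def CoeffGrowth (F : ℚ⟦X⟧) (a : ℤ) : Prop :=
  ∃ C : ℝ, 0 ≤ C ∧ ∀ n : ℕ, |((PowerSeries.coeff n F : ℚ) : ℝ)| ≤ C * ((n : ℝ) + 1) ^ a

/-! ### Coefficient growth under differential operators -/

namespace CoeffGrowth

/-- Since `1 ≤ (n+2)/(n+1) ≤ 2`, an index shift costs only a constant, whatever the sign of `a`. -/
theorem zpow_shift_le (a : ℤ) :
    ∃ C : ℝ, 0 ≤ C ∧ ∀ n : ℕ, ((n : ℝ) + 1) ^ a ≤ C * ((n : ℝ) + 1 + 1) ^ a ∧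
      ((n : ℝ) + 1 + 1) ^ a ≤ C * ((n : ℝ) + 1) ^ a := by
  have h2 (n : ℕ) : (n : ℝ) + 1 + 1 ≤ 2 * ((n : ℝ) + 1) := by
    linarith [(Nat.cast_nonneg n : (0 : ℝ) ≤ n)]
  have key (m n : ℕ) : ((n : ℝ) + 1) ^ m ≤ 2 ^ m * ((n : ℝ) + 1 + 1) ^ m ∧
      ((n : ℝ) + 1 + 1) ^ m ≤ 2 ^ m * ((n : ℝ) + 1) ^ m := by
    rw [← mul_pow, ← mul_pow]
    constructor
    · gcongr
      linarith [(Nat.cast_nonneg n : (0 : ℝ) ≤ n)]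
    · gcongr
      exact h2 n
  obtain ⟨m, rfl | rfl⟩ := a.eq_nat_or_neg
  · exact ⟨2 ^ m, by positivity, fun n => by simpa using key m n⟩
  · refine ⟨2 ^ m, by positivity, fun n => ?_⟩
    obtain ⟨h, h'⟩ := key m n
    simp only [zpow_neg, zpow_natCast]
    constructor
    · rw [← div_eq_mul_inv, le_div_iff₀ (by positivity), inv_mul_le_iff₀ (by positivity)]
      linarith
    · rw [← div_eq_mul_inv, le_div_iff₀ (by positivity), inv_mul_le_iff₀ (by positivity)]
      linarith

variable {F G : ℚ⟦X⟧} {a b : ℤ}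

theorem mono (h : CoeffGrowth F a) (hab : a ≤ b) : CoeffGrowth F b := by
  obtain ⟨C, hC, h⟩ := h
  refine ⟨C, hC, fun n => (h n).trans ?_⟩
  gcongr
  linarith [(Nat.cast_nonneg n : (0 : ℝ) ≤ n)]

theorem zero : CoeffGrowth 0 a := ⟨0, le_rfl, fun n => by simp⟩

theorem add (hF : CoeffGrowth F a) (hG : CoeffGrowth G a) : CoeffGrowth (F + G) a := by
  obtain ⟨C, hC, hF⟩ := hF
  obtain ⟨D, hD, hG⟩ := hG
  refine ⟨C + D, by positivity, fun n => ?_⟩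
  rw [map_add, Rat.cast_add, add_mul]
  exact (abs_add_le _ _).trans (add_le_add (hF n) (hG n))

theorem neg (hF : CoeffGrowth F a) : CoeffGrowth (-F) a := by
  obtain ⟨C, hC, hF⟩ := hF
  exact ⟨C, hC, fun n => by simpa using hF n⟩

theorem sum {ι : Type*} (s : Finset ι) (f : ι → ℚ⟦X⟧) (h : ∀ i ∈ s, CoeffGrowth (f i) a) :
    CoeffGrowth (∑ i ∈ s, f i) a :=
  Finset.sum_induction f (CoeffGrowth · a) (fun _ _ => add) zero h

theorem C_mul (c : ℚ) (hF : CoeffGrowth F a) : CoeffGrowth (PowerSeries.C c * F) a := by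
  obtain ⟨C, hC, hF⟩ := hF
  refine ⟨|(c : ℝ)| * C, by positivity, fun n => ?_⟩
  rw [PowerSeries.coeff_C_mul, Rat.cast_mul, abs_mul, mul_assoc]
  gcongr
  exact hF n

theorem X_mul (hF : CoeffGrowth F a) : CoeffGrowth (PowerSeries.X * F) a := by
  obtain ⟨C, hC, hF⟩ := hF
  obtain ⟨D, hD, h⟩ := zpow_shift_le a
  refine ⟨C * D, by positivity, fun n => ?_⟩
  cases n with
  | zero => simpa using mul_nonneg hC hD
  | succ n =>
    rw [PowerSeries.coeff_succ_X_mul, mul_assoc]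
    push_cast
    exact (hF n).trans (by gcongr; exact (h n).1)

theorem polynomial_mul (p : ℚ[X]) (hF : CoeffGrowth F a) : CoeffGrowth ((p : ℚ⟦X⟧) * F) a := by
  induction p using Polynomial.induction_on with
  | C c => simpa using hF.C_mul c
  | add p q hp hq => simpa [add_mul] using hp.add hq
  | monomial n c h =>
    have := h.X_mul
    convert this using 1
    simp only [Polynomial.coe_mul, Polynomial.coe_C, Polynomial.coe_pow, Polynomial.coe_X]
    ring

theorem derivative (hF : CoeffGrowth F a) :
    CoeffGrowth (PowerSeries.derivative ℚ F) (a + 1) := by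
  obtain ⟨C, hC, hF⟩ := hF
  obtain ⟨D, hD, h⟩ := zpow_shift_le a
  refine ⟨C * D, by positivity, fun n => ?_⟩
  have h0 : (0 : ℝ) < (n : ℝ) + 1 := by positivity
  rw [PowerSeries.coeff_derivative, Rat.cast_mul, abs_mul, zpow_add_one₀ h0.ne', ← mul_assoc]
  push_cast
  rw [abs_of_pos h0]
  gcongr
  have := hF (n + 1)
  push_cast at this
  rw [mul_assoc]
  exact this.trans (by gcongr; exact (h n).2)

/-- Coefficient `n + 1` of `F` is coefficient `n` of `F'` divided by `n + 1`. The bound is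
coefficientwise, so `a = -1` brings no logarithm; the constant term is absorbed into the constant.
-/
theorem of_derivative (hF : CoeffGrowth (PowerSeries.derivative ℚ F) (a + 1)) :
    CoeffGrowth F a := by
  obtain ⟨C, hC, hF⟩ := hF
  obtain ⟨D, hD, h⟩ := zpow_shift_le a
  refine ⟨C * D + |((PowerSeries.coeff 0 F : ℚ) : ℝ)|, by positivity, fun n => ?_⟩
  cases n with
  | zero =>
    simp only [Nat.cast_zero, zero_add, one_zpow, mul_one]
    linarith [mul_nonneg hC hD]
  | succ n =>
    have h0 : (0 : ℝ) < (n : ℝ) + 1 := by positivity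
    have := hF n
    rw [PowerSeries.coeff_derivative, Rat.cast_mul, abs_mul, zpow_add_one₀ h0.ne', ← mul_assoc]
      at this
    push_cast at this ⊢
    rw [abs_of_pos h0] at this
    refine (le_of_mul_le_mul_right this h0).trans ?_
    calc C * ((n : ℝ) + 1) ^ a ≤ C * (D * ((n : ℝ) + 1 + 1) ^ a) := by gcongr; exact (h n).1
      _ ≤ _ := by
        rw [← mul_assoc]
        gcongr
        linarith [abs_nonneg ((PowerSeries.coeff 0 F : ℚ) : ℝ)]

theorem iterate_derivative (hF : CoeffGrowth F a) (i : ℕ) :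
    CoeffGrowth ((PowerSeries.derivative ℚ)^[i] F) (a + i) := by
  induction i with
  | zero => simpa using hF
  | succ i ih =>
    rw [Function.iterate_succ_apply']
    have := ih.derivative
    push_cast
    rwa [← add_assoc]

/-- Multiplying a solution of a linear differential equation by the leading coefficient `p r`
lowers the polynomial growth of its coefficients by one. -/
theorem leading_pow_mul (hF : CoeffGrowth F a) {r : ℕ} {p : ℕ → ℚ[X]}
    (hODE : ∑ i ∈ Finset.range (r + 1),
      (p i : ℚ⟦X⟧) * (PowerSeries.derivative ℚ)^[i] F = 0) (k : ℕ) :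
    ∀ i ≤ r, CoeffGrowth (((p r ^ k : ℚ[X]) : ℚ⟦X⟧) * (PowerSeries.derivative ℚ)^[i] F)
      (a + i - k) := by
  induction k with
  | zero => exact fun i _ => by simpa using hF.iterate_derivative i
  | succ k ih =>
    intro i hi
    induction hi using Nat.decreasingInduction with
    | self =>
      rw [Finset.sum_range_succ] at hODE
      -- At top order the equation trades one factor `p r` for derivatives of order below `r`, each
      -- better by at least one power.
      have h : ((p r ^ (k + 1) : ℚ[X]) : ℚ⟦X⟧) * (PowerSeries.derivative ℚ)^[r] F =
          -∑ i ∈ Finset.range r, (p i : ℚ⟦X⟧) *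
            (((p r ^ k : ℚ[X]) : ℚ⟦X⟧) * (PowerSeries.derivative ℚ)^[i] F) := by
        have h1 : ∑ i ∈ Finset.range r, (p i : ℚ⟦X⟧) *
            (((p r ^ k : ℚ[X]) : ℚ⟦X⟧) * (PowerSeries.derivative ℚ)^[i] F) =
            ((p r ^ k : ℚ[X]) : ℚ⟦X⟧) * ∑ i ∈ Finset.range r,
              (p i : ℚ⟦X⟧) * (PowerSeries.derivative ℚ)^[i] F := by
          rw [Finset.mul_sum]
          exact Finset.sum_congr rfl fun i _ => by ring
        rw [h1, eq_neg_of_add_eq_zero_left hODE, pow_succ, Polynomial.coe_mul]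
        ring
      rw [h]
      refine (sum _ _ fun i hi => ?_).neg
      have hir := Finset.mem_range.1 hi
      exact ((ih i hir.le).polynomial_mul _).mono (by push_cast; omega)
    | of_succ i hi h =>
      -- Below the top, both Leibniz terms of `(p r ^ (k + 1) * F⁽ⁱ⁾)'` have exponent `a + i - k`:
      -- one by the descent on `i`, the other by the induction on `k`. Integration gains the missing
      -- power.
      apply of_derivative
      rw [Derivation.leibniz, ← Function.iterate_succ_apply' (⇑(PowerSeries.derivative ℚ)), smul_eq_mul, smul_eq_mul]
      refine CoeffGrowth.add (h.mono (by push_cast; omega)) ?_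
      have := (ih i (by omega)).polynomial_mul
        (Polynomial.C (k + 1 : ℚ) * Polynomial.derivative (p r))
      convert this.mono (b := a + i - ((k + 1 : ℕ) : ℤ) + 1) (by push_cast; omega) using 1
      rw [PowerSeries.derivative_coe, Polynomial.derivative_pow_succ]
      push_cast
      ring

end CoeffGrowth

/-! ### Rationality from integrality -/

/-- A power series with integer coefficients of polynomial growth that satisfies a linear
differential equation over `ℚ[X]` is rational. -/
theorem IsHolonomic.exists_polynomial_mul_eq {a : ℕ → ℤ} {A : ℤ}
    (hG : CoeffGrowth (PowerSeries.mk fun n => (a n : ℚ)) A)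
    (h : IsHolonomic (PowerSeries.mk fun n => (a n : ℚ))) :
    ∃ Q N : ℚ[X], Q ≠ 0 ∧ (Q : ℚ⟦X⟧) * PowerSeries.mk (fun n => (a n : ℚ)) = N := by
  obtain ⟨r, p, hp, hODE⟩ := h
  obtain ⟨c, hc, hcp⟩ := IsLocalization.integerNormalization_spec (nonZeroDivisors ℤ) (p r)
  set R := IsLocalization.integerNormalization (nonZeroDivisors ℤ) (p r)
  set F := PowerSeries.mk fun n => (a n : ℚ)
  -- This choice gives `A - k ≤ -1`.
  set k := (A + 1).toNat
  have hR : R.map (algebraMap ℤ ℚ) ≠ 0 := by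
    rw [hcp]
    exact smul_ne_zero (nonZeroDivisors.ne_zero hc) hp
  have hgrowth : CoeffGrowth (((R.map (algebraMap ℤ ℚ) ^ k : ℚ[X]) : ℚ⟦X⟧) * F) (-1) := by
    have h1 := (hG.leading_pow_mul hODE k 0 (Nat.zero_le r)).polynomial_mul
      (Polynomial.C ((c : ℚ) ^ k))
    convert h1.mono (b := -1) (by push_cast; omega) using 1
    rw [hcp, zsmul_eq_mul, mul_pow, Polynomial.coe_mul, mul_assoc, ← Polynomial.C_eq_intCast,
      ← Polynomial.C_pow]
    simp
  have hint (n : ℕ) : ∃ z : ℤ,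
      PowerSeries.coeff n (((R.map (algebraMap ℤ ℚ) ^ k : ℚ[X]) : ℚ⟦X⟧) * F) = z := by
    refine ⟨PowerSeries.coeff n (((R ^ k : ℤ[X]) : ℤ⟦X⟧) * PowerSeries.mk a), ?_⟩
    have hF : F = (PowerSeries.mk a).map (algebraMap ℤ ℚ) := by
      ext n
      simp [F]
    rw [hF, ← Polynomial.map_pow, Polynomial.polynomial_map_coe, ← map_mul,
      PowerSeries.coeff_map]
    rfl
  obtain ⟨C, hC, hb⟩ := hgrowth
  -- For `n ≥ ⌈C⌉₊` an integer coefficient bounded by `C / (n + 1) < 1` is zero, so truncation there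
  -- loses nothing.
  refine ⟨R.map (algebraMap ℤ ℚ) ^ k, PowerSeries.trunc (⌈C⌉₊)
    (((R.map (algebraMap ℤ ℚ) ^ k : ℚ[X]) : ℚ⟦X⟧) * F), pow_ne_zero _ hR, ?_⟩
  ext n
  rw [Polynomial.coeff_coe, PowerSeries.coeff_trunc]
  split_ifs with hn
  · rfl
  · obtain ⟨z, hz⟩ := hint n
    have h1 := hb n
    rw [hz] at h1 ⊢
    have hlt : C < (n : ℝ) + 1 := (Nat.ceil_le.1 (not_lt.1 hn)).trans_lt (lt_add_one _)
    have h2 : |((z : ℚ) : ℝ)| < 1 := by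
      refine h1.trans_lt ?_
      rw [zpow_neg_one, ← div_eq_mul_inv, div_lt_one (by positivity)]
      exact hlt
    have h3 : |z| < 1 := by exact_mod_cast h2
    rw [Int.abs_lt_one_iff.1 h3, Int.cast_zero]

/-! ### Behaviour of a rational function at `1` -/

theorem hasSum_polynomial_mul {F : ℚ⟦X⟧} {x s : ℝ}
    (h : HasSum (fun n => ((PowerSeries.coeff n F : ℚ) : ℝ) * x ^ n) s) (Q : ℚ[X]) :
    HasSum (fun n => ((PowerSeries.coeff n ((Q : ℚ⟦X⟧) * F) : ℚ) : ℝ) * x ^ n)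
      (Q.aeval x * s) := by
  induction Q using Polynomial.induction_on with
  | C c =>
    simpa [mul_assoc] using h.mul_left (c : ℝ)
  | add p q hp hq =>
    convert hp.add hq using 1
    · ext n
      simp [add_mul]
    · simp [add_mul]
  | monomial n c ih =>
    have heq : ((Polynomial.C c * Polynomial.X ^ (n + 1) : ℚ[X]) : ℚ⟦X⟧) * F =
        PowerSeries.X * (((Polynomial.C c * Polynomial.X ^ n : ℚ[X]) : ℚ⟦X⟧) * F) := by
      simp only [Polynomial.coe_mul, Polynomial.coe_C, Polynomial.coe_pow, Polynomial.coe_X]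
      ring
    rw [heq, ← hasSum_nat_add_iff' 1]
    have hval : (Polynomial.C c * Polynomial.X ^ (n + 1)).aeval x * s -
        ∑ i ∈ Finset.range 1, ((PowerSeries.coeff i (PowerSeries.X *
          (((Polynomial.C c * Polynomial.X ^ n : ℚ[X]) : ℚ⟦X⟧) * F)) : ℚ) : ℝ) * x ^ i =
        x * ((Polynomial.C c * Polynomial.X ^ n).aeval x * s) := by
      simp [pow_succ]
      ring
    rw [hval]
    simp only [PowerSeries.coeff_succ_X_mul, pow_succ', mul_left_comm _ x]
    exact ih.mul_left x

theorem aeval_mul_eq_of_hasSum {F : ℚ⟦X⟧} {Q N : ℚ[X]} (hQN : (Q : ℚ⟦X⟧) * F = N) {x s : ℝ}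
    (h : HasSum (fun n => ((PowerSeries.coeff n F : ℚ) : ℝ) * x ^ n) s) :
    Q.aeval x * s = N.aeval x := by
  have h1 := hasSum_polynomial_mul h Q
  rw [hQN] at h1
  refine h1.unique ?_
  rw [Polynomial.aeval_eq_sum_range]
  simp only [Polynomial.coeff_coe, Algebra.smul_def]
  exact hasSum_sum_of_ne_finset_zero fun n hn => by
    rw [Polynomial.coeff_eq_zero_of_natDegree_lt (by simpa using hn)]
    simp

/-- A nonnegative function that is a quotient of polynomials to the left of `1` has integral
order at `1`. -/
theorem bounded_or_le_of_eval_mul_eq {f : ℝ → ℝ} {Q N : ℝ[X]} (hQ : Q ≠ 0)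
    (hf : ∀ᶠ x in 𝓝[<] (1 : ℝ), 0 ≤ f x ∧ Q.eval x * f x = N.eval x) (m : ℕ) :
    (∃ C, ∀ᶠ x in 𝓝[<] (1 : ℝ), f x * (1 - x) ^ m ≤ C) ∨
      ∃ c > 0, ∀ᶠ x in 𝓝[<] (1 : ℝ), c ≤ f x * (1 - x) ^ (m + 1) := by
  have hIoo : ∀ᶠ x in 𝓝[<] (1 : ℝ), x ∈ Set.Ioo (0 : ℝ) 1 := Ioo_mem_nhdsLT one_pos
  -- Absolute values make the signs of the cofactors irrelevant, as `f` is nonnegative.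
  have factor {P : ℝ[X]} (hP : P ≠ 0) : ∃ (a : ℕ) (P₁ : ℝ[X]), P₁.eval 1 ≠ 0 ∧
      ∀ x < (1 : ℝ), |P.eval x| = (1 - x) ^ a * |P₁.eval x| := by
    obtain ⟨P₁, h, hdvd⟩ := Polynomial.exists_eq_pow_rootMultiplicity_mul_and_not_dvd P hP 1
    refine ⟨P.rootMultiplicity 1, P₁, fun h0 => hdvd (Polynomial.dvd_iff_isRoot.2 h0), fun x hx => ?_⟩
    conv_lhs => rw [h]
    rw [Polynomial.eval_mul, Polynomial.eval_pow, abs_mul, abs_pow, Polynomial.eval_sub,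
      Polynomial.eval_X, Polynomial.eval_C, abs_sub_comm, abs_of_pos (sub_pos.2 hx)]
  obtain ⟨a, Q₁, hQ₁, hQa⟩ := factor hQ
  have nonzero {P : ℝ[X]} (h : P.eval 1 ≠ 0) : ∀ᶠ x in 𝓝[<] (1 : ℝ), P.eval x ≠ 0 :=
    (P.continuous.continuousAt.eventually_ne h).filter_mono nhdsWithin_le_nhds
  rcases eq_or_ne N 0 with rfl | hN
  · left
    refine ⟨0, ?_⟩
    filter_upwards [hf, hIoo, nonzero hQ₁] with x hx hx1 hq
    have : f x = 0 := by
      have h1 : Q.eval x ≠ 0 := by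
        rw [← abs_pos, hQa x hx1.2]
        have := sub_pos.2 hx1.2
        positivity
      simpa [h1] using hx.2
    simp [this]
  obtain ⟨b, N₁, hN₁, hNb⟩ := factor hN
  set h : ℝ → ℝ := fun x => |N₁.eval x| / |Q₁.eval x|
  have hpos : 0 < h 1 := by positivity
  have hcont : Tendsto h (𝓝[<] 1) (𝓝 (h 1)) := by
    refine Tendsto.mono_left (ContinuousAt.div ?_ ?_ (by positivity)) nhdsWithin_le_nhds
    · exact N₁.continuous.abs.continuousAt
    · exact Q₁.continuous.abs.continuousAt
  have heq : ∀ᶠ x in 𝓝[<] (1 : ℝ), (1 - x) ^ a * f x = (1 - x) ^ b * h x := by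
    filter_upwards [hf, hIoo, nonzero hQ₁] with x hx hx1 hq
    have h1 := congrArg abs hx.2
    rw [abs_mul, hQa x hx1.2, hNb x hx1.2, abs_of_nonneg hx.1] at h1
    have hq' : 0 < |Q₁.eval x| := abs_pos.2 hq
    simp only [h]
    field_simp
    linarith
  -- Here `f` behaves like `(1 - x) ^ (b - a)` up to a positive factor, and the integer `a - b` is
  -- either at most `m` or at least `m + 1`.
  rcases le_or_gt a (b + m) with hab | hab
  · left
    obtain ⟨e, he⟩ := Nat.exists_eq_add_of_le hab
    refine ⟨h 1 + 1, ?_⟩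
    filter_upwards [heq, hIoo, hcont.eventually_le_const (lt_add_one _)] with x hx hx1 hle
    have h0 : 0 < 1 - x := sub_pos.2 hx1.2
    have h1 : f x * (1 - x) ^ m = (1 - x) ^ e * h x := by
      apply mul_left_cancel₀ (pow_pos h0 a).ne'
      calc _ = ((1 - x) ^ a * f x) * (1 - x) ^ m := by ring
        _ = (1 - x) ^ (b + m) * h x := by rw [hx]; ring
        _ = _ := by rw [he]; ring
    rw [h1]
    exact (mul_le_of_le_one_left (by positivity)
      (pow_le_one₀ h0.le (by linarith [hx1.1]))).trans hle
  · right
    obtain ⟨e, rfl⟩ := Nat.exists_eq_add_of_lt hab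
    refine ⟨h 1 / 2, by positivity, ?_⟩
    filter_upwards [heq, hIoo, hcont.eventually_const_le (half_lt_self hpos),
      hf] with x hx hx1 hle hfx
    have h0 : 0 < 1 - x := sub_pos.2 hx1.2
    have h1 : (1 - x) ^ e * (f x * (1 - x) ^ (m + 1)) = h x := by
      apply mul_left_cancel₀ (pow_pos h0 b).ne'
      rw [← hx]
      ring
    refine hle.trans (h1 ▸ mul_le_of_le_one_left ?_ (pow_le_one₀ h0.le (by linarith [hx1.1])))
    have := hfx.1
    positivity

/-! ### Comparison of coefficients with boundary growth -/

theorem pow_le_factorial_mul_choose (n p : ℕ) :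
    (n + 1) ^ p ≤ p.factorial * (n + p).choose p := by
  rw [← Nat.ascFactorial_eq_factorial_mul_choose]
  exact Nat.pow_succ_le_ascFactorial _ _

section Tauberian

variable {γ : ℕ → ℕ} {d : ℕ} {C : ℝ}

theorem summable_of_le_pow (hC : ∀ n, (γ n : ℝ) ≤ C * ((n : ℝ) + 1) ^ d) {x : ℝ}
    (hx : x ∈ Set.Ioo (0 : ℝ) 1) : Summable fun n => (γ n : ℝ) * x ^ n := by
  have hC0 : 0 ≤ C := by
    have := hC 0
    simp only [Nat.cast_zero, zero_add, one_pow, mul_one] at this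
    exact (Nat.cast_nonneg _).trans this
  have hx1 : ‖x‖ < 1 := by rw [Real.norm_of_nonneg hx.1.le]; exact hx.2
  refine Summable.of_nonneg_of_le (fun n => mul_nonneg (Nat.cast_nonneg _) (pow_nonneg hx.1.le _))
    (fun n => ?_) ((summable_choose_mul_geometric_of_norm_lt_one d hx1).mul_left
      (C * d.factorial))
  rw [← mul_assoc, mul_assoc C]
  have hxn := pow_nonneg hx.1.le n
  gcongr
  refine (hC n).trans ?_
  gcongr
  exact_mod_cast pow_le_factorial_mul_choose n d

theorem growthLE_of_eventually_le {f g : ℕ → ℕ} (hf : Monotone f) {K : ℕ} (hK : 1 ≤ K)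
    (hg : Monotone g) (h : ∀ᶠ n in atTop, (f n : ℝ) ≤ C * g (K * n)) : GrowthLE f g := by
  obtain ⟨n₀, hn₀⟩ := eventually_atTop.1 h
  -- One constant serves as dilation (`K`), as factor (`⌈C⌉₊`) and as bound for the terms up to `n₀`
  -- (`f n₀`).
  refine ⟨K + ⌈C⌉₊ + f n₀ + 1, by omega, fun n => ?_⟩
  rcases le_total n n₀ with hn | hn
  · have := hf hn
    exact this.trans (by omega)
  · have h1 : f n ≤ ⌈C⌉₊ * g (K * n) := by
      have : (f n : ℝ) ≤ ⌈C⌉₊ * g (K * n) :=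
        (hn₀ n hn).trans (by gcongr; exact Nat.le_ceil C)
      exact_mod_cast this
    refine (h1.trans ?_).trans (Nat.le_add_right _ _)
    exact Nat.mul_le_mul (by omega) (hg (Nat.mul_le_mul_right _ (by omega)))

/-- By monotonicity the terms from `n` on already sum to at least `γ n * x ^ n / (1 - x)`. At `x = 1
- 1/(2n)`, Bernoulli gives `x ^ n ≥ 1/2`, hence `γ n * n ≤ f x ≤ C * (2n) ^ (d + 1)`. -/
theorem growthLE_pow_of_bounded (hmono : Monotone γ) {f : ℝ → ℝ}
    (hsum : ∀ x ∈ Set.Ioo (0 : ℝ) 1, HasSum (fun n => (γ n : ℝ) * x ^ n) (f x))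
    (h : ∀ᶠ x in 𝓝[<] (1 : ℝ), f x * (1 - x) ^ (d + 1) ≤ C) :
    GrowthLE γ fun n => n ^ d := by
  have hlim : Tendsto (fun n : ℕ => 1 - 1 / ((2 * n : ℕ) : ℝ)) atTop (𝓝[<] 1) := by
    refine tendsto_nhdsWithin_iff.2 ⟨?_, ?_⟩
    · have := (tendsto_one_div_atTop_nhds_zero_nat (𝕜 := ℝ)).comp
        (tendsto_id.const_mul_atTop' (two_pos : 0 < 2))
      simpa using this.const_sub 1
    · filter_upwards [eventually_ge_atTop 1] with n hn
      have : (0 : ℝ) < n := by exact_mod_cast hn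
      rw [Set.mem_Iio, sub_lt_self_iff]
      positivity
  refine growthLE_of_eventually_le (C := C * 2 ^ (d + 1)) hmono le_rfl (pow_left_mono d) ?_
  filter_upwards [hlim.eventually h, eventually_ge_atTop 1] with n hn hn1
  have hn0 : (1 : ℝ) ≤ n := by exact_mod_cast hn1
  set x : ℝ := 1 - 1 / ((2 * n : ℕ) : ℝ) with hx
  have hx1 : 1 - x = 1 / (2 * n) := by rw [hx]; push_cast; ring
  have hhalf : 1 / (2 * (n : ℝ)) ≤ 1 / 2 := by
    apply one_div_le_one_div_of_le two_pos
    linarith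
  have hpos : 0 < 1 / (2 * (n : ℝ)) := by positivity
  have hxmem : x ∈ Set.Ioo (0 : ℝ) 1 := ⟨by linarith, by linarith⟩
  have hpow : 1 / 2 ≤ x ^ n := by
    have := one_add_mul_le_pow (a := x - 1) (by linarith [hxmem.1]) n
    rw [add_sub_cancel] at this
    refine le_trans (le_of_eq ?_) this
    rw [← neg_sub 1 x, hx1]
    field_simp
    norm_num
  have hle : (γ n : ℝ) * x ^ n * (1 - x)⁻¹ ≤ f x := by
    have h1 := (hasSum_nat_add_iff' n).2 (hsum x hxmem)
    have h2 := (hasSum_geometric_of_lt_one hxmem.1.le hxmem.2).mul_left ((γ n : ℝ) * x ^ n)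
    refine (hasSum_le (fun j => ?_) h2 h1).trans (sub_le_self _ (Finset.sum_nonneg fun i _ =>
      mul_nonneg (Nat.cast_nonneg _) (pow_nonneg hxmem.1.le _)))
    rw [mul_assoc, ← pow_add, add_comm n j]
    have := pow_nonneg hxmem.1.le (j + n)
    gcongr
    exact hmono (Nat.le_add_left _ _)
  have h3 : (γ n : ℝ) * n ≤ f x := by
    refine le_trans ?_ hle
    rw [hx1, one_div, inv_inv]
    nlinarith [mul_le_mul_of_nonneg_left hpow (by positivity : 0 ≤ (γ n : ℝ) * (2 * n))]
  rw [hx1, one_div, inv_pow, ← div_eq_mul_inv, div_le_iff₀ (by positivity)] at hn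
  have h4 := h3.trans hn
  rw [one_mul]
  push_cast
  refine le_of_mul_le_mul_right (h4.trans (le_of_eq ?_)) (by positivity : (0 : ℝ) < n)
  ring

/-- At `x = 1 - 1/n`, terms with `j ≤ K * n` contribute at most `γ (K * n) * n`. Beyond that, `(j +
1) ^ d ≤ (j + 1) ^ (d + 1) / (K * n)` bounds the tail by `(D / K) * n ^ (d + 1)`. For large `K` this
is at most half of the lower bound `c * n ^ (d + 1)`. -/
theorem pow_growthLE_of_le (hmono : Monotone γ)
    (hC : ∀ n, (γ n : ℝ) ≤ C * ((n : ℝ) + 1) ^ d) {f : ℝ → ℝ}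
    (hsum : ∀ x ∈ Set.Ioo (0 : ℝ) 1, HasSum (fun n => (γ n : ℝ) * x ^ n) (f x)) {c : ℝ}
    (hc : 0 < c) (h : ∀ᶠ x in 𝓝[<] (1 : ℝ), c ≤ f x * (1 - x) ^ (d + 1)) :
    GrowthLE (fun n => n ^ d) γ := by
  have hC0 : 0 ≤ C := by
    have := hC 0
    simp only [Nat.cast_zero, zero_add, one_pow, mul_one] at this
    exact (Nat.cast_nonneg _).trans this
  have hlim : Tendsto (fun n : ℕ => 1 - 1 / (n : ℝ)) atTop (𝓝[<] 1) := by
    refine tendsto_nhdsWithin_iff.2 ⟨?_, ?_⟩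
    · simpa using (tendsto_one_div_atTop_nhds_zero_nat (𝕜 := ℝ)).const_sub 1
    · filter_upwards [eventually_ge_atTop 1] with n hn
      have : (0 : ℝ) < n := by exact_mod_cast hn
      rw [Set.mem_Iio, sub_lt_self_iff]
      positivity
  set D : ℝ := C * (d + 1).factorial
  set K : ℕ := ⌈2 * D / c⌉₊ + 1
  have hK0 : (0 : ℝ) < K := by positivity
  have hK : D / K ≤ c / 2 := by
    have : 2 * D / c ≤ K := (Nat.le_ceil _).trans (by simp [K])
    rw [div_le_iff₀ hc] at this
    rw [div_le_iff₀ hK0]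
    linarith
  refine growthLE_of_eventually_le (C := 2 / c) (K := K) (pow_left_mono d) (by omega) hmono ?_
  filter_upwards [hlim.eventually h, eventually_ge_atTop 2] with n hn hn2
  have hn0 : (2 : ℝ) ≤ n := by exact_mod_cast hn2
  have hnpos : (0 : ℝ) < n := by linarith
  set x : ℝ := 1 - 1 / (n : ℝ) with hx
  have hx1 : 1 - x = 1 / n := by rw [hx]; ring
  have hhalf : 1 / (n : ℝ) ≤ 1 / 2 := one_div_le_one_div_of_le two_pos hn0
  have hpos : 0 < 1 / (n : ℝ) := by positivity
  have hxmem : x ∈ Set.Ioo (0 : ℝ) 1 := ⟨by linarith, by linarith⟩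
  have hxn : ‖x‖ < 1 := by rw [Real.norm_of_nonneg hxmem.1.le]; exact hxmem.2
  have hle : f x ≤ γ (K * n) * n + D / (K * n) * n ^ (d + 2) := by
    have h1 := (hasSum_geometric_of_lt_one hxmem.1.le hxmem.2).mul_left (γ (K * n) : ℝ)
    -- Binomials replace powers because their series sums exactly to `(1 - x) ^ -(d + 2) = n ^ (d +
    -- 2)`; the factorial in `D` pays for this.
    have h2 := (hasSum_choose_mul_geometric_of_norm_lt_one (d + 1) hxn).mul_left (D / (K * n))
    rw [hx1, one_div, inv_inv] at h1
    rw [hx1, one_div_pow, one_div_one_div] at h2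
    refine hasSum_le (fun j => ?_) (hsum x hxmem) (h1.add h2)
    rw [← mul_assoc, ← add_mul]
    have := pow_nonneg hxmem.1.le j
    gcongr
    rcases le_total j (K * n) with hj | hj
    · have h3 : (γ j : ℝ) ≤ γ (K * n) := by exact_mod_cast hmono hj
      have h4 : 0 ≤ D / (K * n) * ((j + (d + 1)).choose (d + 1) : ℕ) := by positivity
      linarith
    · have hj' : (K : ℝ) * n ≤ (j : ℝ) + 1 := by
        have : ((K * n : ℕ) : ℝ) ≤ j := by exact_mod_cast hj
        push_cast at this
        linarith
      have h3 : ((j : ℝ) + 1) ^ (d + 1) ≤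
          (d + 1).factorial * ((j + (d + 1)).choose (d + 1) : ℕ) := by
        exact_mod_cast pow_le_factorial_mul_choose j (d + 1)
      have h4 : (γ j : ℝ) ≤ D / (K * n) * ((j + (d + 1)).choose (d + 1) : ℕ) := by
        refine (hC j).trans ?_
        rw [div_mul_eq_mul_div, le_div_iff₀ (by positivity)]
        calc C * ((j : ℝ) + 1) ^ d * (K * n) ≤ C * ((j : ℝ) + 1) ^ d * ((j : ℝ) + 1) := by gcongr
          _ = C * ((j : ℝ) + 1) ^ (d + 1) := by ring
          _ ≤ C * ((d + 1).factorial * ((j + (d + 1)).choose (d + 1) : ℕ)) := by gcongr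
          _ = _ := by simp only [D]; ring
      have h5 : (0 : ℝ) ≤ γ (K * n) := Nat.cast_nonneg _
      linarith
  rw [hx1, one_div, inv_pow, ← div_eq_mul_inv, le_div_iff₀ (by positivity)] at hn
  have h6 : D / (K * n) * (n : ℝ) ^ (d + 2) = D / K * n ^ d * n := by
    field_simp
    ring
  have h7 : c * (n : ℝ) ^ d ≤ γ (K * n) + D / K * n ^ d := by
    refine le_of_mul_le_mul_right ?_ hnpos
    rw [add_mul, ← h6, mul_assoc, ← pow_succ]
    exact hn.trans hle
  have h8 : D / K * (n : ℝ) ^ d ≤ c / 2 * n ^ d := by gcongr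
  push_cast
  rw [div_mul_eq_mul_div, le_div_iff₀ hc]
  linarith

end Tauberian

theorem theorem2p13 (γ : ℕ → ℕ) (hmono : Monotone γ) (d : ℕ)
    (hlower : GrowthLT (fun n => n ^ d) γ)
    (hupper : GrowthLT γ (fun n => n ^ (d + 1))) :
    ¬ IsHolonomic (PowerSeries.mk fun n => (γ n : ℚ)) := by
  intro hol
  obtain ⟨C, hC⟩ : ∃ C : ℝ, ∀ n, (γ n : ℝ) ≤ C * ((n : ℝ) + 1) ^ (d + 1) := by
    obtain ⟨l, -, hl⟩ := hupper.1
    refine ⟨l * l ^ (d + 1) + l, fun n => ?_⟩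
    have h1 : (γ n : ℝ) ≤ l * (l * n) ^ (d + 1) + l := by exact_mod_cast hl n
    have h2 : (1 : ℝ) ≤ ((n : ℝ) + 1) ^ (d + 1) := one_le_pow₀ (by simp)
    have h3 : (n : ℝ) ^ (d + 1) ≤ ((n : ℝ) + 1) ^ (d + 1) := by gcongr; simp
    calc (γ n : ℝ) ≤ l * (l * n) ^ (d + 1) + l := h1
      _ = l * l ^ (d + 1) * (n : ℝ) ^ (d + 1) + l * 1 := by ring
      _ ≤ l * l ^ (d + 1) * ((n : ℝ) + 1) ^ (d + 1) + l * ((n : ℝ) + 1) ^ (d + 1) := by gcongr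
      _ = _ := by ring
  have hC0 : 0 ≤ C := by
    have := hC 0
    simp only [Nat.cast_zero, zero_add, one_pow, mul_one] at this
    exact (Nat.cast_nonneg _).trans this
  have hgrowth : CoeffGrowth (PowerSeries.mk fun n => (γ n : ℚ)) (d + 1 : ℕ) :=
    ⟨C, hC0, fun n => by
      rw [zpow_natCast]
      simpa using hC n⟩
  obtain ⟨Q, N, hQ, hQN⟩ :=
    IsHolonomic.exists_polynomial_mul_eq (a := fun n => (γ n : ℤ)) (by simpa using hgrowth)
      (by simpa using hol)
  have hsum (x : ℝ) (hx : x ∈ Set.Ioo (0 : ℝ) 1) :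
      HasSum (fun n => (γ n : ℝ) * x ^ n) (∑' n, (γ n : ℝ) * x ^ n) :=
    (summable_of_le_pow hC hx).hasSum
  have hrat : ∀ᶠ x in 𝓝[<] (1 : ℝ), 0 ≤ ∑' n, (γ n : ℝ) * x ^ n ∧
      (Q.map (algebraMap ℚ ℝ)).eval x * ∑' n, (γ n : ℝ) * x ^ n =
        (N.map (algebraMap ℚ ℝ)).eval x := by
    filter_upwards [Ioo_mem_nhdsLT one_pos] with x hx
    refine ⟨tsum_nonneg fun n => mul_nonneg (Nat.cast_nonneg _) (pow_nonneg hx.1.le _), ?_⟩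
    rw [Polynomial.eval_map_algebraMap, Polynomial.eval_map_algebraMap]
    exact aeval_mul_eq_of_hasSum hQN (by simpa using hsum x hx)
  -- A pole of order `d + 1` corresponds to growth `n ^ d`, so the orders `≤ d + 1` and `≥ d + 2`
  -- are the ones to separate.
  rcases bounded_or_le_of_eval_mul_eq (Polynomial.map_ne_zero hQ) hrat (d + 1) with
    ⟨B, hB⟩ | ⟨c, hc, hle⟩
  · exact hlower.2 ⟨hlower.1, growthLE_pow_of_bounded hmono hsum hB⟩
  · exact hupper.2 ⟨hupper.1, pow_growthLE_of_le hmono hC hsum hc hle⟩
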